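/- Let $n,p\in\mathbb N$, let $t_0<t_f$, let $D\subseteq\mathbb R^n\times\mathbb R^n\times\mathbb R$ be open, and let $f:D\to\mathbb R^n$, $(q,\dot q,t)\mapsto f(q,\dot q,t)$, be of class $C^1$ and such that its Jacobian $\partial f/\partial\dot q$ with respect to the velocity is also of class $C^1$ on $D$ (for instance, $f$ of class $C^2$). Let an initial state $(q_0,v_0)\in\mathbb R^n\times\mathbb R^n$, a function $F:\mathbb R^{2n}\times\mathbb R\to\mathbb R^p$ and a vector $\nu\in\mathbb R^p$ be given. Consider the minimum control effort problem: minimize $$J=\nu^{T}F\big(x(t_f),t_f\big)+\frac12\int_{t_0}^{t_f}u^{T}u\,dt,\qquad x=(q,\dot q),$$ over all square-integrable controls $u:[t_0,t_f]\to\mathbb R^n$ and all continuously differentiable $q:[t_0,t_f]\to\mathbb R^n$ with absolutely continuous velocity $\dot q$ such that $(q(t),\dot q(t),t)\in D$ for all $t\in[t_0,t_f]$, $$\ddot q=f(q,\dot q,t)+u\quad\text{for almost every }t\in[t_0,t_f],$$ subject to the initial conditions $q(t_0)=q_0$, $\dot q(t_0)=v_0$ and the terminal constraints $F(x(t_f),t_f)=0$.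 Theorem. Let $u$ be an optimal control for this problem and $q$ a corresponding optimal trajectory. Then, after modification on a set of measure zero, $u$ is twice continuously differentiable on $[t_0,t_f]$, the matrix function $t\mapsto\frac{\partial f}{\partial\dot q}(q(t),\dot q(t),t)$ is differentiable on $[t_0,t_f]$, and at every $t\in[t_0,t_f]$ $$\ddot u=-\left(\frac{\partial f}{\partial\dot q}\right)^{T}\dot u-\left[\frac{d}{dt}\left(\frac{\partial f}{\partial\dot q}\right)-\frac{\partial f}{\partial q}\right]^{T}u ,$$ where the Jacobians $\partial f/\partial q$, $\partial f/\partial\dot q$ are evaluated at $(q(t),\dot q(t),t)$, $\frac{d}{dt}$ is the total derivative along the trajectory, and derivatives at $t_0$ and $t_f$ are one-sided. -/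

import Mathlib

open MeasureTheory Set
open scoped RealInnerProductSpace

/-- Data of a minimum-effort optimal control problem for `q̈ = f(q, q̇, t) + u`, `q(t) ∈ ℝⁿ`, on the
time interval `[t₀, tf]`, with given initial state and with terminal constraints
`F(q(tf), q̇(tf), tf) = 0 ∈ ℝᵖ`. The vector field `f` lives on the set `D` of triples
`(q, q̇, t)`; `ν` is the multiplier that adjoins the terminal constraints to the cost. -/
structure MinEffortProblem (n p : ℕ) where
  /-- initial time -/
  t₀ : ℝ
  /-- final time -/
  tf : ℝ
  /-- initial position -/
  q₀ : EuclideanSpace ℝ (Fin n)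
  /-- initial velocity -/
  v₀ : EuclideanSpace ℝ (Fin n)
  /-- domain of the vector field -/
  D : Set (EuclideanSpace ℝ (Fin n) × EuclideanSpace ℝ (Fin n) × ℝ)
  /-- the uncontrolled acceleration, as a function of position, velocity and time -/
  f : EuclideanSpace ℝ (Fin n) → EuclideanSpace ℝ (Fin n) → ℝ → EuclideanSpace ℝ (Fin n)
  /-- the terminal constraint function of the state `(q, q̇)` and time -/
  F : EuclideanSpace ℝ (Fin n) × EuclideanSpace ℝ (Fin n) → ℝ → EuclideanSpace ℝ (Fin p)
  /-- the multiplier of the terminal constraints -/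
  ν : EuclideanSpace ℝ (Fin p)

namespace MinEffortProblem

variable {n p : ℕ} (P : MinEffortProblem n p)

/-- The time interval `[t₀, tf]`. -/
def I : Set ℝ := Icc P.t₀ P.tf

/-- The Jacobian `∂f/∂q` at `(q, q̇, t) = (a, b, t)`. -/
noncomputable def dfdq (a b : EuclideanSpace ℝ (Fin n)) (t : ℝ) :
    EuclideanSpace ℝ (Fin n) →L[ℝ] EuclideanSpace ℝ (Fin n) :=
  fderiv ℝ (fun y => P.f y b t) a

/-- The Jacobian `∂f/∂q̇` at `(q, q̇, t) = (a, b, t)`. -/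
noncomputable def dfdv (a b : EuclideanSpace ℝ (Fin n)) (t : ℝ) :
    EuclideanSpace ℝ (Fin n) →L[ℝ] EuclideanSpace ℝ (Fin n) :=
  fderiv ℝ (fun y => P.f a y t) b

/-- `q` is a solution, with velocity `v = q̇`, of `q̈ = f(q, q̇, t) + u` on `[t₀, tf]` under the
square-integrable control `u`. As `u` is only measurable, the equation is understood in the usual
sense of Carathéodory: `v` is the integral of its right-hand side (equivalently, `v` is absolutely
continuous and the equation holds at almost every time). -/
structure IsMotion (q v u : ℝ → EuclideanSpace ℝ (Fin n)) : Prop where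
  control_sq_integrable : MemLp u 2 (volume.restrict P.I)
  mem_domain : ∀ t ∈ P.I, (q t, v t, t) ∈ P.D
  hasDeriv_position : ∀ t ∈ P.I, HasDerivWithinAt q (v t) P.I t
  acceleration_integrable :
    IntervalIntegrable (fun s => P.f (q s) (v s) s + u s) volume P.t₀ P.tf
  velocity_eq : ∀ t ∈ P.I, v t = v P.t₀ + ∫ s in P.t₀..t, (P.f (q s) (v s) s + u s)

/-- Feasibility: a motion with the given initial state that meets the terminal constraints. -/
structure IsFeasible (q v u : ℝ → EuclideanSpace ℝ (Fin n)) : Prop where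
  isMotion : P.IsMotion q v u
  initial_position : q P.t₀ = P.q₀
  initial_velocity : v P.t₀ = P.v₀
  terminal : P.F (q P.tf, v P.tf) P.tf = 0

/-- The cost `J = νᵀ F(x(tf), tf) + ½ ∫ uᵀu dt`. -/
noncomputable def cost (q v u : ℝ → EuclideanSpace ℝ (Fin n)) : ℝ :=
  ⟪P.ν, P.F (q P.tf, v P.tf) P.tf⟫ + (1 / 2) * ∫ t in P.t₀..P.tf, ⟪u t, u t⟫

/-- `u` is an optimal control, with optimal motion `q` and velocity `v = q̇`. -/
structure IsOptimal (q v u : ℝ → EuclideanSpace ℝ (Fin n)) : Prop where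
  isFeasible : P.IsFeasible q v u
  cost_le : ∀ q' v' u' : ℝ → EuclideanSpace ℝ (Fin n),
    P.IsFeasible q' v' u' → P.cost q v u ≤ P.cost q' v' u'

end MinEffortProblem

/-!
The terminal data are arbitrary, so an optimal motion is compared only with motions that have the
same initial and the same final state: for these the constraint and the terminal term of the cost
do not change, and the optimal motion minimizes the control effort alone. Moreover every curve
`q + ε h` in the domain of `f`, with `h''` square-integrable and `h`, `h'` vanishing at both ends, is
such a motion, since the control can be read off from the equation. Hence the first variation vanishes
(`MinEffortProblem.IsOptimal.integral_variation_eq_zero`): writing `A` and `B` for `∂f/∂q̇` and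
`∂f/∂q` along the trajectory,
`∫ ⟪u, h'' - A h' - B h⟫ = 0`.

Put `b = ∫ Bᵀ u` and `a = ∫ (Aᵀ u - b)`. Integrating by parts twice turns the identity into
`∫ ⟪u + a, h''⟫ = 0`. Here `h''` is any square-integrable function with vanishing moments of order
`0` and `1`; the choice of `u + a` minus its orthogonal projection on the affine functions shows that
`u + a` is affine almost everywhere (`exists_ae_eq_affine_of_forall_integral_inner_eq_zero`,
`MinEffortProblem.IsOptimal.exists_integral_equation`).

Thus `u` has a continuous representative `w = c₀ + t c₁ - a`. Then `q̇` is `C¹`, so `A` is `C¹`,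
and differentiating `w' = c₁ - Aᵀ w + b` once more gives the asserted equation.
-/

/-! ### Integrability and differentiability on compact intervals -/

theorem MeasureTheory.MemLp.integrable_real_inner {α E : Type*} [MeasurableSpace α] {μ : Measure α}
    [NormedAddCommGroup E] [InnerProductSpace ℝ E] {f g : α → E}
    (hf : MemLp f 2 μ) (hg : MemLp g 2 μ) : Integrable (fun x => ⟪f x, g x⟫) μ := by
  refine Integrable.mono' (hf.norm.integrable_mul hg.norm) ?_ ?_
  · exact hf.1.inner hg.1
  · exact Filter.Eventually.of_forall fun z => norm_inner_le_norm _ _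

theorem ContinuousOn.memLp_Icc {E : Type*} [NormedAddCommGroup E] {a b : ℝ} {f : ℝ → E}
    (hf : ContinuousOn f (Icc a b)) (p : ENNReal) : MemLp f p (volume.restrict (Icc a b)) := by
  obtain ⟨C, hC⟩ := isCompact_Icc.exists_bound_of_continuousOn hf
  exact MemLp.of_bound (hf.aestronglyMeasurable_of_isCompact isCompact_Icc measurableSet_Icc) C
    ((ae_restrict_iff' measurableSet_Icc).2 (Filter.Eventually.of_forall hC))

theorem MeasureTheory.MemLp.intervalIntegrable_of_restrict_Icc {E : Type*} [NormedAddCommGroup E]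
    {a b : ℝ} (hab : a ≤ b) {f : ℝ → E} {p : ENNReal} (hp : 1 ≤ p)
    (hf : MemLp f p (volume.restrict (Icc a b))) :
    IntervalIntegrable f volume a b :=
  (intervalIntegrable_iff_integrableOn_Icc_of_le hab).2 (hf.integrable hp)

theorem ContinuousOn.hasDerivWithinAt_integral_Icc {E : Type*} [NormedAddCommGroup E]
    [NormedSpace ℝ E] [CompleteSpace E] {a b : ℝ} {f : ℝ → E} (hf : ContinuousOn f (Icc a b))
    {t : ℝ} (ht : t ∈ Icc a b) :
    HasDerivWithinAt (fun t => ∫ s in a..t, f s) (f t) (Icc a b) t := by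
  have : Fact (t ∈ Icc a b) := ⟨ht⟩
  have hsub : Icc a t ⊆ Icc a b := Icc_subset_Icc_right ht.2
  refine intervalIntegral.integral_hasDerivWithinAt_right
    ((hf.mono hsub).intervalIntegrable_of_Icc ht.1) ?_ (hf t ht)
  exact hf.stronglyMeasurableAtFilter_nhdsWithin measurableSet_Icc t

theorem contDiffOn_two_of_hasDerivWithinAt {E : Type*} [NormedAddCommGroup E] [NormedSpace ℝ E]
    {s : Set ℝ} (hs : UniqueDiffOn ℝ s) {w w₁ w₂ : ℝ → E}
    (h₁ : ∀ t ∈ s, HasDerivWithinAt w (w₁ t) s t) (h₂ : ∀ t ∈ s, HasDerivWithinAt w₁ (w₂ t) s t)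
    (h₃ : ContinuousOn w₂ s) : ContDiffOn ℝ 2 w s := by
  have e₁ : EqOn (derivWithin w s) w₁ s := fun t ht => (h₁ t ht).derivWithin (hs t ht)
  have e₂ : EqOn (derivWithin w₁ s) w₂ s := fun t ht => (h₂ t ht).derivWithin (hs t ht)
  have c₁ : ContDiffOn ℝ 1 w₁ s := by
    rw [show (1 : WithTop ℕ∞) = 0 + 1 by simp, contDiffOn_succ_iff_derivWithin hs]
    exact ⟨fun t ht => (h₂ t ht).differentiableWithinAt, by simp,
      contDiffOn_zero.2 (h₃.congr e₂)⟩
  rw [show (2 : WithTop ℕ∞) = 1 + 1 by norm_num, contDiffOn_succ_iff_derivWithin hs]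
  exact ⟨fun t ht => (h₁ t ht).differentiableWithinAt, by simp, c₁.congr e₁⟩

theorem HasDerivWithinAt.clm_adjoint {E F : Type*} [NormedAddCommGroup E] [InnerProductSpace ℝ E]
    [CompleteSpace E] [NormedAddCommGroup F] [InnerProductSpace ℝ F] [CompleteSpace F]
    {A : ℝ → E →L[ℝ] F} {A' : E →L[ℝ] F} {s : Set ℝ} {t : ℝ} (h : HasDerivWithinAt A A' s t) :
    HasDerivWithinAt (fun t => (A t).adjoint) A'.adjoint s t := by
  -- `adjoint` is bundled as a conjugate-linear isometry; over `ℝ` it is a bounded linear map.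
  have hb : IsBoundedLinearMap ℝ (fun B : E →L[ℝ] F => B.adjoint) :=
    ⟨⟨map_add _, fun c B => by simp⟩, 1, one_pos, fun B => by
      simp only [one_mul]; exact (LinearIsometryEquiv.norm_map _ _).le⟩
  exact hb.toContinuousLinearMap.hasFDerivAt.comp_hasDerivWithinAt t h

theorem ContinuousOn.memLp_clm_apply {E F : Type*} [NormedAddCommGroup E] [NormedSpace ℝ E]
    [NormedAddCommGroup F] [NormedSpace ℝ F] {a b : ℝ} {A : ℝ → E →L[ℝ] F} {u : ℝ → E}
    {p : ENNReal} (hA : ContinuousOn A (Icc a b)) (hu : MemLp u p (volume.restrict (Icc a b))) :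
    MemLp (fun t => A t (u t)) p (volume.restrict (Icc a b)) := by
  obtain ⟨C, hC⟩ := isCompact_Icc.exists_bound_of_continuousOn hA
  refine hu.of_le_mul (c := C) ?_ ?_
  · exact (ContinuousLinearMap.id ℝ (E →L[ℝ] F)).aestronglyMeasurable_comp₂
      (hA.aestronglyMeasurable_of_isCompact isCompact_Icc measurableSet_Icc) hu.1
  · refine (ae_restrict_iff' measurableSet_Icc).2 (Filter.Eventually.of_forall fun t ht => ?_)
    exact (A t).le_of_opNorm_le (hC t ht) _

/-! ### Integration by parts and the du Bois-Reymond lemma -/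

/-- Integration by parts for two merely integrable functions: both sides are the integral of
`⟪f s, g t⟫` over the triangle `a < s ≤ t ≤ b`. -/
theorem integral_inner_primitive_left {E : Type*} [NormedAddCommGroup E] [InnerProductSpace ℝ E]
    [CompleteSpace E] {a b : ℝ} (hab : a ≤ b) {f g : ℝ → E}
    (hf : IntervalIntegrable f volume a b) (hg : IntervalIntegrable g volume a b) :
    ∫ t in a..b, ⟪∫ s in a..t, f s, g t⟫ = ∫ s in a..b, ⟪f s, ∫ t in s..b, g t⟫ := by
  rw [intervalIntegrable_iff_integrableOn_Ioc_of_le hab] at hf hg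
  set μ : Measure ℝ := volume.restrict (Ioc a b) with hμ
  have hf' : Integrable f μ := hf
  have hg' : Integrable g μ := hg
  have hprod : Integrable (fun z : ℝ × ℝ => ⟪f z.1, g z.2⟫) (μ.prod μ) := by
    refine Integrable.mono' (hf'.norm.mul_prod hg'.norm) ?_ ?_
    · exact hf'.aestronglyMeasurable.comp_fst.inner hg'.aestronglyMeasurable.comp_snd
    · exact Filter.Eventually.of_forall fun z => norm_inner_le_norm _ _
  have hmeas : MeasurableSet {z : ℝ × ℝ | z.1 ≤ z.2} := measurableSet_le measurable_fst measurable_snd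
  have hind := hprod.indicator hmeas
  have hswap := integral_integral_swap
    (f := fun s t => {z : ℝ × ℝ | z.1 ≤ z.2}.indicator (fun z : ℝ × ℝ => ⟪f z.1, g z.2⟫) (s, t))
    (μ := μ) (ν := μ) hind
  rw [intervalIntegral.integral_of_le hab, intervalIntegral.integral_of_le hab]
  have h1 : ∀ t ∈ Ioc a b, ⟪∫ s in a..t, f s, g t⟫ =
      ∫ s, {z : ℝ × ℝ | z.1 ≤ z.2}.indicator (fun z : ℝ × ℝ => ⟪f z.1, g z.2⟫) (s, t) ∂μ := by
    intro t ht
    have e : (fun s => {z : ℝ × ℝ | z.1 ≤ z.2}.indicator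
        (fun z : ℝ × ℝ => ⟪f z.1, g z.2⟫) (s, t)) = (Iic t).indicator (fun s => ⟪f s, g t⟫) := by
      ext s; simp [indicator]
    rw [e, integral_indicator measurableSet_Iic, hμ, Measure.restrict_restrict measurableSet_Iic,
      intervalIntegral.integral_of_le ht.1.le]
    have e2 : Iic t ∩ Ioc a b = Ioc a t := by
      ext s; simp only [mem_inter_iff, mem_Iic, mem_Ioc]
      exact ⟨fun h => ⟨h.2.1, h.1⟩, fun h => ⟨h.2, h.1, h.2.trans ht.2⟩⟩
    rw [e2, real_inner_comm, ← integral_inner (hf.mono_set (Ioc_subset_Ioc_right ht.2))]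
    simp_rw [real_inner_comm]
  have h2 : ∀ s ∈ Ioc a b, ⟪f s, ∫ t in s..b, g t⟫ =
      ∫ t, {z : ℝ × ℝ | z.1 ≤ z.2}.indicator (fun z : ℝ × ℝ => ⟪f z.1, g z.2⟫) (s, t) ∂μ := by
    intro s hs
    have e : (fun t => {z : ℝ × ℝ | z.1 ≤ z.2}.indicator
        (fun z : ℝ × ℝ => ⟪f z.1, g z.2⟫) (s, t)) = (Ici s).indicator (fun t => ⟪f s, g t⟫) := by
      ext t; simp [indicator]
    rw [e, integral_indicator measurableSet_Ici, hμ, Measure.restrict_restrict measurableSet_Ici,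
      intervalIntegral.integral_of_le hs.2, ← integral_Icc_eq_integral_Ioc]
    have e2 : Ici s ∩ Ioc a b = Icc s b := by
      ext t; simp only [mem_inter_iff, mem_Ici, mem_Ioc, mem_Icc]
      exact ⟨fun h => ⟨h.1, h.2.2⟩, fun h => ⟨h.1, hs.1.trans_le h.1, h.2⟩⟩
    rw [e2, ← integral_inner (hg.mono_set fun t ht => ⟨hs.1.trans_le ht.1, ht.2⟩)]
  rw [setIntegral_congr_fun measurableSet_Ioc h1, setIntegral_congr_fun measurableSet_Ioc h2]
  exact hswap.symm

theorem integral_inner_primitive_left_of_integral_eq_zero {E : Type*} [NormedAddCommGroup E]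
    [InnerProductSpace ℝ E] [CompleteSpace E] {a b : ℝ} (hab : a ≤ b) {f g : ℝ → E}
    (hf : IntervalIntegrable f volume a b) (hg : IntervalIntegrable g volume a b)
    (hg0 : ∫ t in a..b, g t = 0) :
    ∫ t in a..b, ⟪∫ s in a..t, f s, g t⟫ = -∫ t in a..b, ⟪f t, ∫ s in a..t, g s⟫ := by
  rw [integral_inner_primitive_left hab hf hg, ← intervalIntegral.integral_neg]
  refine intervalIntegral.integral_congr fun s hs => ?_
  have h1 := intervalIntegral.integral_add_adjacent_intervals
    (hg.mono_set (uIcc_subset_uIcc_left hs)) (hg.mono_set (uIcc_subset_uIcc_right hs))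
  rw [hg0] at h1
  rw [eq_neg_of_add_eq_zero_right h1, inner_neg_right]

/-- The second primitive of a function with vanishing moments of order `0` and `1` vanishes at the
right endpoint. -/
theorem integral_primitive_eq_zero {E : Type*} [NormedAddCommGroup E]
    [InnerProductSpace ℝ E] [CompleteSpace E] {a b : ℝ} (hab : a ≤ b) {φ : ℝ → E}
    (hφ : IntervalIntegrable φ volume a b) (h0 : ∫ t in a..b, φ t = 0)
    (h1 : ∫ t in a..b, t • φ t = 0) :
    ∫ t in a..b, ∫ s in a..t, φ s = 0 := by
  set S := ∫ t in a..b, ∫ s in a..t, φ s with hS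
  have hk : IntervalIntegrable (fun t => ∫ s in a..t, φ s) volume a b :=
    (intervalIntegral.continuousOn_primitive_interval' hφ left_mem_uIcc).intervalIntegrable
  have htφ : IntervalIntegrable (fun t => t • φ t) volume a b := hφ.continuousOn_smul continuousOn_id
  have hbφ : IntervalIntegrable (fun t => b • φ t) volume a b := hφ.smul b
  -- Integration by parts against the constant `S` computes `⟪S, S⟫` from the two moments.
  have hb := integral_inner_primitive_left hab hφ (intervalIntegrable_const (c := S))
  have e1 : ∫ t in a..b, ⟪∫ s in a..t, φ s, S⟫ = ⟪S, S⟫ := by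
    simp_rw [real_inner_comm S]
    rw [intervalIntegral.integral_of_le hab] at hS ⊢
    rw [integral_inner ((intervalIntegrable_iff_integrableOn_Ioc_of_le hab).1 hk), ← hS]
  have e2 : ∫ s in a..b, ⟪φ s, ∫ _t in s..b, S⟫ = 0 := by
    have e : ∀ s, ⟪φ s, ∫ _t in s..b, S⟫ = ⟪S, b • φ s - s • φ s⟫ := fun s => by
      rw [intervalIntegral.integral_const, ← sub_smul, real_inner_smul_right, real_inner_smul_right,
        real_inner_comm]
    simp_rw [e]
    have h2 : ∫ s in a..b, (b • φ s - s • φ s) = 0 := by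
      rw [intervalIntegral.integral_sub hbφ htφ, intervalIntegral.integral_smul, h0, h1]
      simp
    have h3 : IntervalIntegrable (fun s => b • φ s - s • φ s) volume a b := hbφ.sub htφ
    rw [intervalIntegral.integral_of_le hab] at h2 ⊢
    rw [integral_inner ((intervalIntegrable_iff_integrableOn_Ioc_of_le hab).1 h3), h2,
      inner_zero_right]
  rw [e1, e2] at hb
  exact inner_self_eq_zero.1 hb

/-- The second-order du Bois-Reymond lemma in `L²`: a function orthogonal to all square-integrable
functions with vanishing moments of order `0` and `1` is affine. -/
theorem exists_ae_eq_affine_of_forall_integral_inner_eq_zero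
    {E : Type*} [NormedAddCommGroup E] [InnerProductSpace ℝ E] [CompleteSpace E]
    {a b : ℝ} (hab : a < b) {z : ℝ → E} (hz : MemLp z 2 (volume.restrict (Icc a b)))
    (h : ∀ φ : ℝ → E, MemLp φ 2 (volume.restrict (Icc a b)) →
      ∫ t in Icc a b, φ t = 0 → ∫ t in Icc a b, t • φ t = 0 →
      ∫ t in Icc a b, ⟪z t, φ t⟫ = 0) :
    ∃ c₀ c₁ : E, z =ᵐ[volume.restrict (Icc a b)] fun t => c₀ + t • c₁ := by
  set μ : Measure ℝ := volume.restrict (Icc a b) with hμ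
  set m : ℝ := (a + b) / 2
  set T : ℝ := b - a
  have hT : T ≠ 0 := (sub_pos.2 hab).ne'
  have hz1 : Integrable z μ := hz.integrable (by norm_num)
  have hid : ContinuousOn (fun t : ℝ => t) (Icc a b) := continuousOn_id
  have htz : ∀ {y : ℝ → E}, MemLp y 2 μ → Integrable (fun t => t • y t) μ := fun hy =>
    IntegrableOn.continuousOn_smul (hy.integrable (by norm_num)) hid isCompact_Icc
  set S₀ : E := ∫ t, z t ∂μ
  set S₁ : E := ∫ t, t • z t ∂μ
  have i0 : ∫ _t, (1 : ℝ) ∂μ = T := by simp [hμ, T, hab.le]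
  have i1 : ∫ t, (t : ℝ) ∂μ = T * m := by
    rw [hμ, integral_Icc_eq_integral_Ioc, ← intervalIntegral.integral_of_le hab.le, integral_id]
    simp only [T, m]; ring
  have i2 : ∫ t, (t ^ 2 : ℝ) ∂μ = (b ^ 3 - a ^ 3) / 3 := by
    rw [hμ, integral_Icc_eq_integral_Ioc, ← intervalIntegral.integral_of_le hab.le, integral_pow]
    norm_num
  -- `c₀ + t • c₁` is the orthogonal projection of `z` on the affine functions: `T ^ 3 / 12` is the
  -- second moment of the interval about its midpoint `m`.
  set c₁ : E := (12 / T ^ 3) • (S₁ - m • S₀) with hc₁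
  set c₀ : E := (1 / T) • S₀ - m • c₁ with hc₀
  have hlcont : ContinuousOn (fun t : ℝ => c₀ + t • c₁) (Icc a b) := by fun_prop
  have hl : MemLp (fun t : ℝ => c₀ + t • c₁) 2 μ := hlcont.memLp_Icc 2
  have j1 : Integrable (fun t : ℝ => t • c₁) μ :=
    ((by fun_prop : ContinuousOn (fun t : ℝ => t • c₁) (Icc a b)).memLp_Icc 1).integrable le_rfl
  have j0 : Integrable (fun t : ℝ => t • c₀) μ :=
    ((by fun_prop : ContinuousOn (fun t : ℝ => t • c₀) (Icc a b)).memLp_Icc 1).integrable le_rfl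
  have j2 : Integrable (fun t : ℝ => t ^ 2 • c₁) μ :=
    ((by fun_prop : ContinuousOn (fun t : ℝ => t ^ 2 • c₁) (Icc a b)).memLp_Icc 1).integrable le_rfl
  have jc : Integrable (fun _ : ℝ => c₀) μ :=
    ((by fun_prop : ContinuousOn (fun _ : ℝ => c₀) (Icc a b)).memLp_Icc 1).integrable le_rfl
  have l0 : ∫ t, (c₀ + t • c₁) ∂μ = T • c₀ + (T * m) • c₁ := by
    rw [integral_add jc j1, integral_smul_const, i1]
    congr 1
    rw [← i0, ← integral_smul_const]; simp
  have l1 : ∫ t, t • (c₀ + t • c₁) ∂μ = (T * m) • c₀ + ((b ^ 3 - a ^ 3) / 3) • c₁ := by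
    have : (fun t : ℝ => t • (c₀ + t • c₁)) = fun t => t • c₀ + t ^ 2 • c₁ := by
      ext t; rw [smul_add, smul_smul, sq]
    rw [this, integral_add j0 j2, integral_smul_const, integral_smul_const, i1, i2]
  set φ : ℝ → E := fun t => z t - (c₀ + t • c₁) with hφ
  have hφm : MemLp φ 2 μ := hz.sub hl
  have hφ0 : ∫ t, φ t ∂μ = 0 := by
    rw [hφ, integral_sub hz1 (hl.integrable (by norm_num)), l0, hc₀, smul_sub, smul_smul, smul_smul,
      mul_one_div_cancel hT, one_smul]
    simp [S₀]
  have hφ1 : ∫ t, t • φ t ∂μ = 0 := by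
    have e : (fun t => t • φ t) = fun t => t • z t - t • (c₀ + t • c₁) := by
      ext t; rw [hφ, smul_sub]
    rw [e, integral_sub (htz hz) (htz hl), l1]
    have e3 : (b ^ 3 - a ^ 3) / 3 = T * m ^ 2 + T ^ 3 / 12 := by simp only [T, m]; ring
    have e4 : (T ^ 3 / 12) • c₁ = S₁ - m • S₀ := by
      rw [hc₁, smul_smul]
      have : T ^ 3 / 12 * (12 / T ^ 3) = 1 := by field_simp
      rw [this, one_smul]
    rw [e3, add_smul, e4, hc₀, smul_sub, smul_smul, smul_smul]
    have e5 : T * m * (1 / T) = m := by field_simp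
    rw [e5, show T * m * m = T * m ^ 2 by ring]
    change S₁ - _ = 0
    abel
  have hzφ := h φ hφm hφ0 hφ1
  have hlφ : ∫ t, ⟪c₀ + t • c₁, φ t⟫ ∂μ = 0 := by
    have e : (fun t => ⟪c₀ + t • c₁, φ t⟫) = fun t => ⟪c₀, φ t⟫ + ⟪c₁, t • φ t⟫ := by
      ext t; rw [inner_add_left, real_inner_smul_left, real_inner_smul_right]
    have g0 := hφm.integrable (μ := μ) (by norm_num)
    rw [e, integral_add (g0.const_inner _) ((htz hφm).const_inner _),
      integral_inner g0, integral_inner (htz hφm), hφ0, hφ1]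
    simp
  have hφφ : ∫ t, ⟪φ t, φ t⟫ ∂μ = 0 := by
    have e : (fun t => ⟪φ t, φ t⟫) = fun t => ⟪z t, φ t⟫ - ⟪c₀ + t • c₁, φ t⟫ := by
      ext t; rw [← inner_sub_left]
    rw [e, integral_sub (hz.integrable_real_inner hφm) (hl.integrable_real_inner hφm), hlφ, hzφ,
      sub_zero]
  rw [integral_eq_zero_iff_of_nonneg (fun t => real_inner_self_nonneg)
    (hφm.integrable_real_inner hφm)] at hφφ
  refine ⟨c₀, c₁, ?_⟩
  filter_upwards [hφφ] with t ht
  exact sub_eq_zero.1 (inner_self_eq_zero.1 ht)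

/-! ### The first variation -/

namespace MinEffortProblem

variable {n p : ℕ} {P : MinEffortProblem n p}

/-- The derivative of `(q, q̇, t) ↦ f(q, q̇, t)` at fixed time, by the partial Jacobians. -/
theorem fderiv_slice {z : EuclideanSpace ℝ (Fin n) × EuclideanSpace ℝ (Fin n) × ℝ}
    (hz : DifferentiableAt ℝ (fun z : EuclideanSpace ℝ (Fin n) × EuclideanSpace ℝ (Fin n) × ℝ =>
      P.f z.1 z.2.1 z.2.2) z) (x y : EuclideanSpace ℝ (Fin n)) :
    fderiv ℝ (fun z : EuclideanSpace ℝ (Fin n) × EuclideanSpace ℝ (Fin n) × ℝ =>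
      P.f z.1 z.2.1 z.2.2) z (x, y, 0) =
      P.dfdq z.1 z.2.1 z.2.2 x + P.dfdv z.1 z.2.1 z.2.2 y := by
  obtain ⟨a, b, t⟩ := z
  have hq : HasFDerivAt (fun y => P.f y b t) _ a :=
    hz.hasFDerivAt.comp (f := fun y => (y, b, t)) a
      ((hasFDerivAt_id a).prodMk (hasFDerivAt_const (b, t) a))
  have hv : HasFDerivAt (fun y => P.f a y t) _ b :=
    hz.hasFDerivAt.comp (f := fun y => (a, y, t)) b
      ((hasFDerivAt_const a b).prodMk ((hasFDerivAt_id b).prodMk (hasFDerivAt_const t b)))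
  simp only [dfdq, dfdv]
  rw [hq.fderiv, hv.fderiv]
  simp only [ContinuousLinearMap.comp_apply, ContinuousLinearMap.prod_apply]
  rw [← map_add]
  simp

theorem IsMotion.continuousOn_position {q v u : ℝ → EuclideanSpace ℝ (Fin n)}
    (h : P.IsMotion q v u) : ContinuousOn q P.I :=
  fun t ht => (h.hasDeriv_position t ht).continuousWithinAt

theorem IsMotion.continuousOn_velocity {q v u : ℝ → EuclideanSpace ℝ (Fin n)}
    (h : P.IsMotion q v u) (ht : P.t₀ < P.tf) : ContinuousOn v P.I := by
  have h1 := intervalIntegral.continuousOn_primitive_interval' h.acceleration_integrable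
    left_mem_uIcc
  rw [uIcc_of_le ht.le] at h1
  exact (continuousOn_const.add h1).congr h.velocity_eq

theorem IsMotion.continuousOn_phase {q v u : ℝ → EuclideanSpace ℝ (Fin n)}
    (h : P.IsMotion q v u) (ht : P.t₀ < P.tf) : ContinuousOn (fun t => (q t, v t, t)) P.I :=
  h.continuousOn_position.prodMk ((h.continuousOn_velocity ht).prodMk continuousOn_id)

/-- The first variation of the control effort vanishes. The motion `q + ε h`, with velocity `v + ε k`,
`h' = k`, `k' = φ`, is driven by the control `u + ε φ + f(q, v, t) - f(q + ε h, v + ε k, t)`. As `h`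
and `k` vanish at both ends of the time interval, it is feasible whatever the terminal constraint
function is. -/
theorem IsOptimal.integral_variation_eq_zero (ht : P.t₀ < P.tf) (hD : IsOpen P.D)
    (hf : ContDiffOn ℝ 1 (fun z : EuclideanSpace ℝ (Fin n) × EuclideanSpace ℝ (Fin n) × ℝ =>
      P.f z.1 z.2.1 z.2.2) P.D)
    {q v u : ℝ → EuclideanSpace ℝ (Fin n)} (hopt : P.IsOptimal q v u)
    {h k φ : ℝ → EuclideanSpace ℝ (Fin n)} (hφ : MemLp φ 2 (volume.restrict P.I))
    (hk : ∀ t ∈ P.I, k t = ∫ s in P.t₀..t, φ s) (hk1 : k P.tf = 0)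
    (hh : ∀ t ∈ P.I, HasDerivWithinAt h (k t) P.I t) (hh0 : h P.t₀ = 0) (hh1 : h P.tf = 0) :
    ∫ t in P.t₀..P.tf,
      ⟪u t, φ t - (P.dfdq (q t) (v t) t (h t) + P.dfdv (q t) (v t) t (k t))⟫ = 0 := by
  have hM := hopt.isFeasible.isMotion
  set G := fun z : EuclideanSpace ℝ (Fin n) × EuclideanSpace ℝ (Fin n) × ℝ =>
      P.f z.1 z.2.1 z.2.2 with hG
  have hGd : ∀ z ∈ P.D, HasFDerivAt G (fderiv ℝ G z) z := fun z hz =>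
    ((hf.contDiffAt (hD.mem_nhds hz)).differentiableAt one_ne_zero).hasFDerivAt
  have hG' : ContinuousOn (fderiv ℝ G) P.D := hf.continuousOn_fderiv_of_isOpen hD le_rfl
  have t0I : P.t₀ ∈ P.I := left_mem_Icc.2 ht.le
  have hIoc : uIoc P.t₀ P.tf ⊆ P.I := by rw [uIoc_of_le ht.le]; exact Ioc_subset_Icc_self
  have hφi : IntervalIntegrable φ volume P.t₀ P.tf :=
    hφ.intervalIntegrable_of_restrict_Icc ht.le (by norm_num)
  have hk0 : k P.t₀ = 0 := by rw [hk _ t0I, intervalIntegral.integral_same]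
  have hhc : ContinuousOn h P.I := fun t ht => (hh t ht).continuousWithinAt
  have hkc : ContinuousOn k P.I := by
    have h1 := intervalIntegral.continuousOn_primitive_interval' hφi left_mem_uIcc
    rw [uIcc_of_le ht.le] at h1
    exact h1.congr hk
  set γ : ℝ → ℝ → EuclideanSpace ℝ (Fin n) × EuclideanSpace ℝ (Fin n) × ℝ :=
    fun ε t => (q t + ε • h t, v t + ε • k t, t) with hγ
  have hγc : ∀ ε, ContinuousOn (γ ε) P.I := fun ε =>
    (hM.continuousOn_position.add (hhc.const_smul ε)).prodMk
      (((hM.continuousOn_velocity ht).add (hkc.const_smul ε)).prodMk continuousOn_id)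
  have hγ0 : ∀ t, γ 0 t = (q t, v t, t) := fun t => by simp [hγ]
  have hcomp : IsCompact (γ 0 '' P.I) := isCompact_Icc.image_of_continuousOn (hγc 0)
  have hsub : γ 0 '' P.I ⊆ P.D := by
    rintro _ ⟨t, ht, rfl⟩; rw [hγ0]; exact hM.mem_domain t ht
  obtain ⟨δ, δpos, hδ⟩ := hcomp.exists_cthickening_subset_open hD hsub
  -- On the compact tube `K` around the trajectory, `f` and its derivative are bounded; this provides
  -- the dominating function for differentiation under the integral.
  set K := Metric.cthickening δ (γ 0 '' P.I)
  have hK : IsCompact K := hcomp.cthickening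
  obtain ⟨C, hC⟩ := hK.exists_bound_of_continuousOn (hf.continuousOn.mono hδ)
  obtain ⟨C', hC'⟩ := hK.exists_bound_of_continuousOn (hG'.mono hδ)
  obtain ⟨M, hM'⟩ := isCompact_Icc.exists_bound_of_continuousOn
    (hhc.prodMk (hkc.prodMk (continuousOn_const (c := (0 : ℝ)))))
  have hMpos : 0 ≤ M := (norm_nonneg _).trans (hM' _ t0I)
  set r : ℝ := min 1 (δ / (M + 1))
  have rpos : 0 < r := lt_min one_pos (by positivity)
  have hγK : ∀ ε ∈ Metric.ball (0 : ℝ) r, ∀ t ∈ P.I, γ ε t ∈ K := by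
    intro ε hε t ht
    refine Metric.mem_cthickening_of_dist_le (γ ε t) (γ 0 t) δ _ (mem_image_of_mem _ ht) ?_
    have e : γ ε t - γ 0 t = ε • (h t, k t, (0 : ℝ)) := by simp [hγ]
    rw [dist_eq_norm, e, norm_smul]
    have h1 : ‖ε‖ ≤ δ / (M + 1) := (mem_ball_zero_iff.1 hε).le.trans (min_le_right _ _)
    calc ‖ε‖ * ‖(h t, k t, (0 : ℝ))‖ ≤ δ / (M + 1) * (M + 1) := by
          gcongr
          exact (hM' t ht).trans (by linarith)
      _ = δ := by field_simp
  -- `U ε` is the control driving the varied motion, `U' ε` its derivative in `ε`.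
  set U : ℝ → ℝ → EuclideanSpace ℝ (Fin n) :=
    fun ε t => u t + ε • φ t + (G (γ 0 t) - G (γ ε t)) with hU
  set U' : ℝ → ℝ → EuclideanSpace ℝ (Fin n) :=
    fun ε t => φ t - fderiv ℝ G (γ ε t) (h t, k t, 0) with hU'
  have hU0 : ∀ t, U 0 t = u t := fun t => by simp [hU]
  have hGc : ∀ ε ∈ Metric.ball (0 : ℝ) r, ContinuousOn (fun t => G (γ ε t)) P.I := fun ε hε =>
    hf.continuousOn.comp (hγc ε) fun t ht => hδ (hγK ε hε t ht)
  have h0r : (0 : ℝ) ∈ Metric.ball (0 : ℝ) r := Metric.mem_ball_self rpos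
  have hUL : ∀ ε ∈ Metric.ball (0 : ℝ) r, MemLp (U ε) 2 (volume.restrict P.I) := fun ε hε =>
    (hM.control_sq_integrable.add (hφ.const_smul ε)).add
      (((hGc 0 h0r).sub (hGc ε hε)).memLp_Icc 2)
  have hUd : ∀ t ∈ P.I, ∀ ε ∈ Metric.ball (0 : ℝ) r,
      HasDerivAt (fun ε => U ε t) (U' ε t) ε := by
    intro t ht ε hε
    have hγd : HasDerivAt (fun ε => γ ε t) (h t, k t, 0) ε := by
      have h1 : HasDerivAt (fun ε : ℝ => q t + ε • h t) (h t) ε := by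
        simpa using ((hasDerivAt_id ε).smul_const (h t)).const_add (q t)
      have h2 : HasDerivAt (fun ε : ℝ => v t + ε • k t) (k t) ε := by
        simpa using ((hasDerivAt_id ε).smul_const (k t)).const_add (v t)
      exact h1.prodMk (h2.prodMk (hasDerivAt_const ε t))
    have h3 := (hGd _ (hδ (hγK ε hε t ht))).comp_hasDerivAt ε hγd
    have h4 : HasDerivAt (fun ε : ℝ => u t + ε • φ t) (φ t) ε := by
      simpa using ((hasDerivAt_id ε).smul_const (φ t)).const_add (u t)
    have h5 := h4.add (h3.const_sub (G (γ 0 t)))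
    rw [← sub_eq_add_neg] at h5
    exact h5
  -- The varied motion has the same initial and final states, hence is feasible with the same
  -- terminal term in the cost; only the control effort is compared.
  have hmin : IsLocalMin (fun ε => ∫ t in P.t₀..P.tf, ⟪U ε t, U ε t⟫) 0 := by
    filter_upwards [Metric.ball_mem_nhds (0 : ℝ) rpos] with ε hε
    have hacc : ∀ s, P.f (q s + ε • h s) (v s + ε • k s) s + U ε s =
        (P.f (q s) (v s) s + u s) + ε • φ s := by
      intro s; simp only [hU, hG, hγ, zero_smul, add_zero]; abel
    have hend : ∀ t ∈ P.I, HasDerivWithinAt (fun t => q t + ε • h t) (v t + ε • k t) P.I t :=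
      fun t ht => (hM.hasDeriv_position t ht).add ((hh t ht).const_smul ε)
    have hfeas : P.IsFeasible (fun t => q t + ε • h t) (fun t => v t + ε • k t) (U ε) := by
      refine ⟨⟨hUL ε hε, fun t ht => hδ (hγK ε hε t ht), hend, ?_, ?_⟩, ?_, ?_, ?_⟩
      · simp only [hacc]
        exact hM.acceleration_integrable.add (hφi.smul ε)
      · intro t htI
        have hs : uIcc P.t₀ t ⊆ uIcc P.t₀ P.tf := by
          rw [uIcc_of_le htI.1, uIcc_of_le ht.le]; exact Icc_subset_Icc_right htI.2
        have hεφ : IntervalIntegrable (fun s => ε • φ s) volume P.t₀ t := (hφi.mono_set hs).smul ε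
        simp only [hacc]
        rw [intervalIntegral.integral_add (hM.acceleration_integrable.mono_set hs) hεφ,
          intervalIntegral.integral_smul, ← hk t htI,
          hM.velocity_eq t htI, hk0]
        simp [add_assoc]
      · simp [hh0, hopt.isFeasible.initial_position]
      · simp [hk0, hopt.isFeasible.initial_velocity]
      · simp [hh1, hk1, hopt.isFeasible.terminal]
    have hle := hopt.cost_le _ _ _ hfeas
    simp only [cost, hh1, hk1, smul_zero, add_zero] at hle
    simp only [hU0]
    linarith
  have hφ' : MemLp (fun t => ‖φ t‖ + C' * M) 2 (volume.restrict P.I) :=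
    hφ.norm.add (continuousOn_const.memLp_Icc 2)
  have hu' : MemLp (fun t => ‖u t‖ + ‖φ t‖ + 2 * C) 2 (volume.restrict P.I) :=
    (hM.control_sq_integrable.norm.add hφ.norm).add (continuousOn_const.memLp_Icc 2)
  have hii : ∀ {g : ℝ → ℝ}, Integrable g (volume.restrict P.I) →
      IntervalIntegrable g volume P.t₀ P.tf := fun hg =>
    (intervalIntegrable_iff_integrableOn_Icc_of_le ht.le).2 hg
  have hU'm : AEStronglyMeasurable (U' 0) (volume.restrict P.I) := by
    refine hφ.1.sub ?_
    have : ContinuousOn (fun t => fderiv ℝ G (γ 0 t) (h t, k t, 0)) P.I :=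
      (hG'.comp (hγc 0) fun t ht => hδ (hγK 0 h0r t ht)).clm_apply
        (hhc.prodMk (hkc.prodMk continuousOn_const))
    exact this.aestronglyMeasurable_of_isCompact isCompact_Icc measurableSet_Icc
  have hderiv := intervalIntegral.hasDerivAt_integral_of_dominated_loc_of_deriv_le
    (μ := volume) (a := P.t₀) (b := P.tf)
    (F := fun ε t => ⟪U ε t, U ε t⟫) (F' := fun ε t => ⟪U ε t, U' ε t⟫ + ⟪U' ε t, U ε t⟫)
    (x₀ := (0 : ℝ)) (s := Metric.ball (0 : ℝ) r)
    (bound := fun t => 2 * ((‖u t‖ + ‖φ t‖ + 2 * C) * (‖φ t‖ + C' * M)))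
    (Metric.ball_mem_nhds (0 : ℝ) rpos)
    (by
      filter_upwards [Metric.ball_mem_nhds (0 : ℝ) rpos] with ε hε
      exact ((hUL ε hε).1.inner (hUL ε hε).1).mono_measure (Measure.restrict_mono hIoc le_rfl))
    (hii ((hUL 0 h0r).integrable_real_inner (hUL 0 h0r)))
    (by
      exact (((hUL 0 h0r).1.inner hU'm).add (hU'm.inner (hUL 0 h0r).1)).mono_measure
        (Measure.restrict_mono hIoc le_rfl))
    (by
      refine Filter.Eventually.of_forall fun t htI ε hε => ?_
      have htI := hIoc htI
      have hε1 : ‖ε‖ ≤ 1 := (mem_ball_zero_iff.1 hε).le.trans (min_le_left _ _)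
      have n1 : ‖U ε t‖ ≤ ‖u t‖ + ‖φ t‖ + 2 * C := by
        have a1 := hC _ (hγK ε hε t htI)
        have a2 := hC _ (hγK 0 h0r t htI)
        have a3 : ‖ε • φ t‖ ≤ ‖φ t‖ := by
          rw [norm_smul]; exact mul_le_of_le_one_left (norm_nonneg _) hε1
        have a4 := norm_add_le (u t + ε • φ t) (G (γ 0 t) - G (γ ε t))
        have a5 := norm_add_le (u t) (ε • φ t)
        have a6 := norm_sub_le (G (γ 0 t)) (G (γ ε t))
        simp only [hU]
        linarith
      have n2 : ‖U' ε t‖ ≤ ‖φ t‖ + C' * M := by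
        refine (norm_sub_le _ _).trans (add_le_add le_rfl ?_)
        refine (ContinuousLinearMap.le_opNorm _ _).trans ?_
        have := hC' _ (hγK ε hε t htI)
        exact mul_le_mul this (hM' t htI) (norm_nonneg _) ((norm_nonneg _).trans this)
      have n3 : ‖U ε t‖ * ‖U' ε t‖ ≤ (‖u t‖ + ‖φ t‖ + 2 * C) * (‖φ t‖ + C' * M) :=
        mul_le_mul n1 n2 (norm_nonneg _) ((norm_nonneg _).trans n1)
      rw [real_inner_comm (U ε t) (U' ε t), ← two_mul, norm_mul, Real.norm_two]
      have := norm_inner_le_norm (𝕜 := ℝ) (U ε t) (U' ε t)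
      linarith)
    (hii ((hu'.integrable_mul hφ').const_mul 2))
    (Filter.Eventually.of_forall fun t htI ε hε =>
      (hUd t (hIoc htI) ε hε).inner ℝ (hUd t (hIoc htI) ε hε))
  have hzero := hmin.hasDerivAt_eq_zero hderiv.2
  have hcongr : ∀ t ∈ uIcc P.t₀ P.tf, ⟪U 0 t, U' 0 t⟫ + ⟪U' 0 t, U 0 t⟫ =
      2 * ⟪u t, φ t - (P.dfdq (q t) (v t) t (h t) + P.dfdv (q t) (v t) t (k t))⟫ := by
    intro t htI
    rw [uIcc_of_le ht.le] at htI
    have hz : DifferentiableAt ℝ G (q t, v t, t) :=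
      (hGd _ (hM.mem_domain t htI)).differentiableAt
    rw [real_inner_comm (U 0 t) (U' 0 t), ← two_mul, hU0]
    simp only [hU']
    rw [hγ0, fderiv_slice hz]
  rw [intervalIntegral.integral_congr hcongr, intervalIntegral.integral_const_mul] at hzero
  linarith

/-! ### The Euler–Lagrange equation and regularity -/

theorem continuousOn_dfdq (hD : IsOpen P.D)
    (hf : ContDiffOn ℝ 1 (fun z : EuclideanSpace ℝ (Fin n) × EuclideanSpace ℝ (Fin n) × ℝ =>
      P.f z.1 z.2.1 z.2.2) P.D) :
    ContinuousOn (fun z : EuclideanSpace ℝ (Fin n) × EuclideanSpace ℝ (Fin n) × ℝ =>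
      P.dfdq z.1 z.2.1 z.2.2) P.D := by
  have h := (hf.continuousOn_fderiv_of_isOpen hD le_rfl).clm_comp
    (continuousOn_const (c := ContinuousLinearMap.inl ℝ (EuclideanSpace ℝ (Fin n))
      (EuclideanSpace ℝ (Fin n) × ℝ)))
  refine h.congr fun z hz => ?_
  ext1 x
  have := fderiv_slice ((hf.contDiffAt (hD.mem_nhds hz)).differentiableAt one_ne_zero) x 0
  rw [map_zero, add_zero] at this
  exact this.symm

/-- The Euler–Lagrange equation in integrated form: an optimal control equals, almost everywhere, an
affine function of time minus the primitive of `(∂f/∂q̇)ᵀ u - ∫ (∂f/∂q)ᵀ u`. The vanishing first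
variation is integrated by parts until only the variation `φ` of the acceleration is left, tested
against `u` plus that primitive; such a function is affine. -/
theorem IsOptimal.exists_integral_equation (ht : P.t₀ < P.tf) (hD : IsOpen P.D)
    (hf : ContDiffOn ℝ 1 (fun z : EuclideanSpace ℝ (Fin n) × EuclideanSpace ℝ (Fin n) × ℝ =>
      P.f z.1 z.2.1 z.2.2) P.D)
    (hfv : ContinuousOn (fun z : EuclideanSpace ℝ (Fin n) × EuclideanSpace ℝ (Fin n) × ℝ =>
      P.dfdv z.1 z.2.1 z.2.2) P.D)
    {q v u : ℝ → EuclideanSpace ℝ (Fin n)} (hopt : P.IsOptimal q v u) :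
    ∃ c₀ c₁ : EuclideanSpace ℝ (Fin n), u =ᵐ[volume.restrict P.I] fun t =>
      c₀ + t • c₁ - ∫ s in P.t₀..t, ((P.dfdv (q s) (v s) s).adjoint (u s) -
        ∫ r in P.t₀..s, (P.dfdq (q r) (v r) r).adjoint (u r)) := by
  have hM := hopt.isFeasible.isMotion
  have hu := hM.control_sq_integrable
  have hAc : ContinuousOn (fun t => (P.dfdv (q t) (v t) t).adjoint) P.I :=
    ContinuousLinearMap.adjoint.continuous.comp_continuousOn
      (hfv.comp (hM.continuousOn_phase ht) hM.mem_domain)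
  have hBc : ContinuousOn (fun t => (P.dfdq (q t) (v t) t).adjoint) P.I :=
    ContinuousLinearMap.adjoint.continuous.comp_continuousOn
      ((continuousOn_dfdq hD hf).comp (hM.continuousOn_phase ht) hM.mem_domain)
  set g := fun t => (P.dfdv (q t) (v t) t).adjoint (u t)
  set m := fun t => (P.dfdq (q t) (v t) t).adjoint (u t)
  have hg : IntervalIntegrable g volume P.t₀ P.tf :=
    (hAc.memLp_clm_apply hu).intervalIntegrable_of_restrict_Icc ht.le one_le_two
  have hm : IntervalIntegrable m volume P.t₀ P.tf :=
    (hBc.memLp_clm_apply hu).intervalIntegrable_of_restrict_Icc ht.le one_le_two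
  have hbc := intervalIntegral.continuousOn_primitive_interval' hm left_mem_uIcc
  set b := fun s => ∫ r in P.t₀..s, m r with hb
  have hgb : IntervalIntegrable (fun s => g s - b s) volume P.t₀ P.tf :=
    hg.sub hbc.intervalIntegrable
  have hac := intervalIntegral.continuousOn_primitive_interval' hgb left_mem_uIcc
  set a := fun t => ∫ s in P.t₀..t, (g s - b s) with ha
  rw [uIcc_of_le ht.le] at hac
  have hz : MemLp (fun t => u t + a t) 2 (volume.restrict P.I) := hu.add (hac.memLp_Icc 2)
  have hset : ∀ {E : Type} [NormedAddCommGroup E] [NormedSpace ℝ E] (y : ℝ → E),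
      ∫ t in Icc P.t₀ P.tf, y t = ∫ t in P.t₀..P.tf, y t := fun y => by
    rw [integral_Icc_eq_integral_Ioc, intervalIntegral.integral_of_le ht.le]
  have key : ∃ c₀ c₁, (fun t => u t + a t) =ᵐ[volume.restrict P.I] fun t => c₀ + t • c₁ := by
    refine exists_ae_eq_affine_of_forall_integral_inner_eq_zero ht hz fun φ hφ hφ0 hφ1 => ?_
    rw [hset] at hφ0 hφ1 ⊢
    have hφi := hφ.intervalIntegrable_of_restrict_Icc ht.le one_le_two
    have hkc := intervalIntegral.continuousOn_primitive_interval' hφi left_mem_uIcc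
    rw [uIcc_of_le ht.le] at hkc
    set k := fun t => ∫ s in P.t₀..t, φ s with hk
    set h := fun t => ∫ s in P.t₀..t, k s with hh
    have hki : IntervalIntegrable k volume P.t₀ P.tf := hkc.intervalIntegrable_of_Icc ht.le
    have hh1 : ∫ t in P.t₀..P.tf, k t = 0 := integral_primitive_eq_zero ht.le hφi hφ0 hφ1
    -- `φ` has vanishing moments of order `0` and `1`, so its first two primitives `k` and `h` vanish
    -- at the final time and give an admissible variation.
    have hvar := hopt.integral_variation_eq_zero ht hD hf (h := h) (k := k) hφ
      (fun t _ => rfl) hφ0 (fun t htI => hkc.hasDerivWithinAt_integral_Icc htI)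
      intervalIntegral.integral_same hh1
    have hhc : ContinuousOn h P.I := fun t htI =>
      (hkc.hasDerivWithinAt_integral_Icc htI).continuousWithinAt
    have hii : ∀ {x y : ℝ → EuclideanSpace ℝ (Fin n)}, MemLp x 2 (volume.restrict P.I) →
        MemLp y 2 (volume.restrict P.I) →
        IntervalIntegrable (fun t => ⟪x t, y t⟫) volume P.t₀ P.tf := fun hx hy =>
      (intervalIntegrable_iff_integrableOn_Icc_of_le ht.le).2 (hx.integrable_real_inner hy)
    have hmL : MemLp m 2 (volume.restrict P.I) := hBc.memLp_clm_apply hu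
    have hgL : MemLp g 2 (volume.restrict P.I) := hAc.memLp_clm_apply hu
    rw [uIcc_of_le ht.le] at hbc
    have hbL : MemLp b 2 (volume.restrict P.I) := hbc.memLp_Icc 2
    have haL : MemLp a 2 (volume.restrict P.I) := hac.memLp_Icc 2
    have hkL : MemLp k 2 (volume.restrict P.I) := hkc.memLp_Icc 2
    have hhL : MemLp h 2 (volume.restrict P.I) := hhc.memLp_Icc 2
    have e : ∀ t, ⟪u t, φ t - (P.dfdq (q t) (v t) t (h t) + P.dfdv (q t) (v t) t (k t))⟫ =
        ⟪u t, φ t⟫ - (⟪m t, h t⟫ + ⟪g t, k t⟫) := fun t => by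
      simp only [m, g, inner_sub_right, inner_add_right, ContinuousLinearMap.adjoint_inner_left]
    simp_rw [e] at hvar
    rw [intervalIntegral.integral_sub (hii hu hφ) ((hii hmL hhL).add (hii hgL hkL)),
      intervalIntegral.integral_add (hii hmL hhL) (hii hgL hkL)] at hvar
    -- Move the derivative from `h` onto the primitive of `m`, then the one from `k` onto `a`.
    have p1 := integral_inner_primitive_left_of_integral_eq_zero ht.le hm hki hh1
    have p2 := integral_inner_primitive_left_of_integral_eq_zero ht.le hgb hφi hφ0
    change ∫ t in P.t₀..P.tf, ⟪b t, k t⟫ = -∫ t in P.t₀..P.tf, ⟪m t, h t⟫ at p1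
    change ∫ t in P.t₀..P.tf, ⟪a t, φ t⟫ = -∫ t in P.t₀..P.tf, ⟪g t - b t, k t⟫ at p2
    simp_rw [inner_sub_left] at p2
    rw [intervalIntegral.integral_sub (hii hgL hkL) (hii hbL hkL)] at p2
    simp_rw [inner_add_left]
    rw [intervalIntegral.integral_add (hii hu hφ) (hii haL hφ)]
    linarith
  obtain ⟨c₀, c₁, hc⟩ := key
  refine ⟨c₀, c₁, ?_⟩
  filter_upwards [hc] with t h
  exact eq_sub_of_add_eq h

end MinEffortProblem

theorem mainTheorem1 {n p : ℕ} (P : MinEffortProblem n p)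
    (ht : P.t₀ < P.tf) (hD : IsOpen P.D)
    (hf : ContDiffOn ℝ 1 (fun z : EuclideanSpace ℝ (Fin n) × EuclideanSpace ℝ (Fin n) × ℝ =>
      P.f z.1 z.2.1 z.2.2) P.D)
    (hfv : ContDiffOn ℝ 1 (fun z : EuclideanSpace ℝ (Fin n) × EuclideanSpace ℝ (Fin n) × ℝ =>
      P.dfdv z.1 z.2.1 z.2.2) P.D)
    (q v u : ℝ → EuclideanSpace ℝ (Fin n)) (hopt : P.IsOptimal q v u) :
    ∃ w : ℝ → EuclideanSpace ℝ (Fin n),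
      u =ᵐ[volume.restrict P.I] w ∧
      ContDiffOn ℝ 2 w P.I ∧
      DifferentiableOn ℝ (fun s => P.dfdv (q s) (v s) s) P.I ∧
      ∀ t ∈ P.I,
        derivWithin (derivWithin w P.I) P.I t =
          -(P.dfdv (q t) (v t) t).adjoint (derivWithin w P.I t)
          - (derivWithin (fun s => P.dfdv (q s) (v s) s) P.I t
              - P.dfdq (q t) (v t) t).adjoint (w t) := by
  have hM := hopt.isFeasible.isMotion
  have hγ := hM.continuousOn_phase ht
  have hI : UniqueDiffOn ℝ P.I := uniqueDiffOn_Icc ht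
  obtain ⟨c₀, c₁, hc⟩ := hopt.exists_integral_equation ht hD hf hfv.continuousOn
  set w := fun t => c₀ + t • c₁ - ∫ s in P.t₀..t, ((P.dfdv (q s) (v s) s).adjoint (u s) -
        ∫ r in P.t₀..s, (P.dfdq (q r) (v r) r).adjoint (u r)) with hw
  have hAc : ContinuousOn (fun t => (P.dfdv (q t) (v t) t).adjoint) P.I :=
    ContinuousLinearMap.adjoint.continuous.comp_continuousOn
      (hfv.continuousOn.comp hγ hM.mem_domain)
  have hBc : ContinuousOn (fun t => (P.dfdq (q t) (v t) t).adjoint) P.I :=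
    ContinuousLinearMap.adjoint.continuous.comp_continuousOn
      ((P.continuousOn_dfdq hD hf).comp hγ hM.mem_domain)
  -- Under integrals `u` may be replaced by its continuous representative `w`, which makes the
  -- integrands continuous and the primitives differentiable everywhere.
  have hcongr : ∀ {G : ℝ → EuclideanSpace ℝ (Fin n) → EuclideanSpace ℝ (Fin n)}, ∀ t ∈ P.I,
      ∫ s in P.t₀..t, G s (u s) = ∫ s in P.t₀..t, G s (w s) := by
    intro G t htI
    rw [intervalIntegral.integral_of_le htI.1, intervalIntegral.integral_of_le htI.1]
    refine integral_congr_ae ?_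
    have hsub : Ioc P.t₀ t ⊆ P.I := fun s hs => ⟨hs.1.le, hs.2.trans htI.2⟩
    filter_upwards [ae_restrict_of_ae_restrict_of_subset hsub hc] with s hs
    rw [hs]
  have hwc : ContinuousOn w P.I := by
    have hu := hM.control_sq_integrable
    have h1 := (hAc.memLp_clm_apply hu).intervalIntegrable_of_restrict_Icc ht.le one_le_two
    have h2 := (hBc.memLp_clm_apply hu).intervalIntegrable_of_restrict_Icc ht.le one_le_two
    have h3 := intervalIntegral.continuousOn_primitive_interval' (h1.sub
      (intervalIntegral.continuousOn_primitive_interval' h2 left_mem_uIcc).intervalIntegrable)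
      left_mem_uIcc
    rw [uIcc_of_le ht.le] at h3
    exact ContinuousOn.sub (by fun_prop) h3
  set b := fun t => ∫ r in P.t₀..t, (P.dfdq (q r) (v r) r).adjoint (w r) with hb
  have hbd : ∀ t ∈ P.I, HasDerivWithinAt b ((P.dfdq (q t) (v t) t).adjoint (w t)) P.I t :=
    fun t htI => (hBc.clm_apply hwc).hasDerivWithinAt_integral_Icc htI
  have hbc : ContinuousOn b P.I := fun t htI => (hbd t htI).continuousWithinAt
  set w₁ := fun t => c₁ - ((P.dfdv (q t) (v t) t).adjoint (w t) - b t) with hw₁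
  have hwd : ∀ t ∈ P.I, HasDerivWithinAt w (w₁ t) P.I t := by
    intro t htI
    have hlin : HasDerivWithinAt (fun t : ℝ => c₀ + t • c₁) c₁ P.I t := by
      simpa using ((hasDerivWithinAt_id t P.I).smul_const c₁).const_add c₀
    have hint := ((hAc.clm_apply hwc).sub hbc).hasDerivWithinAt_integral_Icc htI
    refine (hlin.sub hint).congr_of_mem (fun s hs => ?_) htI
    simp only [hw, Pi.sub_apply]
    congr 1
    rw [hcongr (G := fun r x => (P.dfdv (q r) (v r) r).adjoint x -
        ∫ r in P.t₀..r, (P.dfdq (q r) (v r) r).adjoint (u r)) s hs]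
    refine intervalIntegral.integral_congr fun r hr => ?_
    rw [uIcc_of_le hs.1] at hr
    rw [hcongr (G := fun r x => (P.dfdq (q r) (v r) r).adjoint x) r ⟨hr.1, hr.2.trans hs.2⟩]
  -- With `w` in place of `u` the velocity is `C¹`, so `∂f/∂q̇` is `C¹` along the trajectory, and `w₁`
  -- can be differentiated once more.
  have hfc : ContinuousOn (fun t => P.f (q t) (v t) t + w t) P.I :=
    (hf.continuousOn.comp hγ hM.mem_domain).add hwc
  have hvd : ∀ t ∈ P.I, HasDerivWithinAt v (P.f (q t) (v t) t + w t) P.I t := by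
    intro t htI
    refine ((hfc.hasDerivWithinAt_integral_Icc htI).const_add (v P.t₀)).congr_of_mem
      (fun s hs => ?_) htI
    rw [hM.velocity_eq s hs, hcongr (G := fun s x => P.f (q s) (v s) s + x) s hs]
  set A' := fun t => fderiv ℝ (fun z : EuclideanSpace ℝ (Fin n) × EuclideanSpace ℝ (Fin n) × ℝ =>
      P.dfdv z.1 z.2.1 z.2.2) (q t, v t, t) (v t, P.f (q t) (v t) t + w t, 1) with hA'
  have hAd : ∀ t ∈ P.I, HasDerivWithinAt (fun s => P.dfdv (q s) (v s) s) (A' t) P.I t := by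
    intro t htI
    have h1 := ((hfv.contDiffAt (hD.mem_nhds (hM.mem_domain t htI))).differentiableAt
      one_ne_zero).hasFDerivAt
    exact h1.comp_hasDerivWithinAt (f := fun t => (q t, v t, t)) t
      ((hM.hasDeriv_position t htI).prodMk ((hvd t htI).prodMk (hasDerivWithinAt_id t P.I)))
  have hA'c : ContinuousOn A' P.I :=
    ((hfv.continuousOn_fderiv_of_isOpen hD le_rfl).comp hγ hM.mem_domain).clm_apply
      ((hM.continuousOn_velocity ht).prodMk (hfc.prodMk continuousOn_const))
  set w₂ := fun t => -(((A' t).adjoint (w t) + (P.dfdv (q t) (v t) t).adjoint (w₁ t)) -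
    (P.dfdq (q t) (v t) t).adjoint (w t)) with hw₂
  have hw₁d : ∀ t ∈ P.I, HasDerivWithinAt w₁ (w₂ t) P.I t := fun t htI =>
    (((hAd t htI).clm_adjoint.clm_apply (hwd t htI)).sub (hbd t htI)).const_sub c₁
  have hw₁c : ContinuousOn w₁ P.I := fun t htI => (hw₁d t htI).continuousWithinAt
  have hw₂c : ContinuousOn w₂ P.I :=
    ((((ContinuousLinearMap.adjoint.continuous.comp_continuousOn hA'c).clm_apply hwc).add
      (hAc.clm_apply hw₁c)).sub (hBc.clm_apply hwc)).neg
  refine ⟨w, hc, contDiffOn_two_of_hasDerivWithinAt hI hwd hw₁d hw₂c,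
    fun t htI => (hAd t htI).differentiableWithinAt, fun t htI => ?_⟩
  have e₁ : EqOn (derivWithin w P.I) w₁ P.I := fun s hs => (hwd s hs).derivWithin (hI s hs)
  rw [derivWithin_congr e₁ (e₁ htI), (hw₁d t htI).derivWithin (hI t htI), e₁ htI,
    (hAd t htI).derivWithin (hI t htI),
    map_sub ContinuousLinearMap.adjoint, sub_apply]
  simp only [hw₂]
  abel
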